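/- Let $I=[0,1]$ and let $a\in L^1(I)$ be real-valued. For $\lambda\in\mathbb R$ put $L[\lambda]u=u''+(a+\lambda)u$ on $W^{2,1}(I)=\{u\in C^1(I): u'\text{ is absolutely continuous on } I\}$, the equation $L[\lambda]u=0$ being understood almost everywhere. Consider the periodic boundary conditions $u(0)=u(1)$, $u'(0)=u'(1)$ and the Dirichlet boundary conditions $u(0)=u(1)=0$. For either kind of boundary conditions, a Green's function of $L[\lambda]$ is a function $G:I\times I\to\mathbb R$ such that (i) $G$ is continuous on $I\times I$ and continuously differentiable on $(I\times I)\setminus\{(s,s):s\in I\}$; (ii) for each $s\in(0,1)$, $G(\cdot,s)$ restricted to $[0,s]$ and to $[s,1]$ is of class $W^{2,1}$ and satisfies $L[\lambda]G(\cdot,s)=0$ a.e. there (with one-sided derivatives at the end points), and $G(\cdot,s)$ satisfies the boundary conditions; (iii) for each $t\in(0,1)$ the lateral limits $\frac{\partial G}{\partial t}(t^-,t)=\frac{\partial G}{\partial t}(t,t^+)$ and $\frac{\partial G}{\partial t}(t^+,t)=\frac{\partial G}{\partial t}(t,t^-)$ exist, with the equalities indicated, and $\frac{\partial G}{\partial t}(t^+,t)-\frac{\partial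 G}{\partial t}(t^-,t)=1$. Then there is a smallest $\lambda\in\mathbb R$ for which $L[\lambda]u=0$ has a solution $u\in W^{2,1}(I)$, $u\not\equiv0$, satisfying the periodic boundary conditions; denote it by $\lambda_0^P$. For every $\lambda<\lambda_0^P$, the operator $L[\lambda]$ has a Green's function $G_P[\lambda]$ for the periodic and a Green's function $G_D[\lambda]$ for the Dirichlet boundary conditions, and all such Green's functions satisfy $$G_P[\lambda](t,s)<G_D[\lambda](t,s)<0\qquad\text{for all }(t,s)\in(0,1)\times(0,1).$$ -/

import Mathlib

open Set Filter Topology MeasureTheory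

namespace Hill

/-- `u` belongs to `W^{2,1}([c, d])` (it is differentiable and `u'` is absolutely continuous) and
`u'' + q u = 0` almost everywhere on `[c, d]`. Derivatives at `c`, `d` are one-sided. -/
def SolvesOn (q u : ℝ → ℝ) (c d : ℝ) : Prop :=
  DifferentiableOn ℝ u (Icc c d) ∧
  AbsolutelyContinuousOnInterval (derivWithin u (Icc c d)) c d ∧
  ∀ᵐ t ∂(volume.restrict (Icc c d)), HasDerivAt (derivWithin u (Icc c d)) (-(q t * u t)) t

/-- Dirichlet conditions `u(0) = u(1) = 0`. -/
def DirichletBC (u : ℝ → ℝ) : Prop :=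
  u 0 = 0 ∧ u 1 = 0

/-- Periodic conditions `u(0) = u(1)`, `u'(0) = u'(1)`, with one-sided derivatives. -/
def PeriodicBC (u : ℝ → ℝ) : Prop :=
  u 0 = u 1 ∧ derivWithin u (Icc 0 1) 0 = derivWithin u (Icc 0 1) 1

/-- `μ` is an eigenvalue: `u'' + (a + μ) u = 0` has a solution in `W^{2,1}([0, 1])`, not
identically zero on `[0, 1]`, that satisfies the boundary conditions `bc`. -/
def IsEigenvalue (a : ℝ → ℝ) (bc : (ℝ → ℝ) → Prop) (μ : ℝ) : Prop :=
  ∃ u : ℝ → ℝ, SolvesOn (fun t => a t + μ) u 0 1 ∧ bc u ∧ ∃ t ∈ Icc (0 : ℝ) 1, u t ≠ 0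

/-- `G` is a Green's function on `[0, 1] × [0, 1]` for the operator `u'' + q u` with homogeneous
boundary conditions `bc`. The first argument of `G` is `t`, the second one is `s`. -/
structure IsGreenFunction (q : ℝ → ℝ) (bc : (ℝ → ℝ) → Prop) (G : ℝ → ℝ → ℝ) : Prop where
  /-- `G` is continuous on the square. -/
  continuousOn : ContinuousOn (fun p : ℝ × ℝ => G p.1 p.2) (Icc 0 1 ×ˢ Icc 0 1)
  /-- `G` is continuously differentiable on the square away from the diagonal. -/
  contDiffOn : ContDiffOn ℝ 1 (fun p : ℝ × ℝ => G p.1 p.2)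
    ((Icc 0 1 ×ˢ Icc 0 1) \ {p : ℝ × ℝ | p.1 = p.2})
  /-- `G(·, s)` solves the homogeneous equation to the left of `s`. -/
  solves_left : ∀ s ∈ Ioo (0 : ℝ) 1, SolvesOn q (fun t => G t s) 0 s
  /-- `G(·, s)` solves the homogeneous equation to the right of `s`. -/
  solves_right : ∀ s ∈ Ioo (0 : ℝ) 1, SolvesOn q (fun t => G t s) s 1
  /-- `G(·, s)` satisfies the boundary conditions. -/
  boundary : ∀ s ∈ Ioo (0 : ℝ) 1, bc (fun t => G t s)
  /-- The lateral limits of `∂G/∂t` at the diagonal exist, those taken from the same side of the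
  diagonal agree, and the jump of `∂G/∂t` across the diagonal is `1`. -/
  jump : ∀ t ∈ Ioo (0 : ℝ) 1, ∃ l r : ℝ,
    Tendsto (fun x => deriv (fun y => G y t) x) (𝓝[<] t) (𝓝 l) ∧
    Tendsto (fun s => deriv (fun y => G y s) t) (𝓝[>] t) (𝓝 l) ∧
    Tendsto (fun x => deriv (fun y => G y t) x) (𝓝[>] t) (𝓝 r) ∧
    Tendsto (fun s => deriv (fun y => G y s) t) (𝓝[<] t) (𝓝 r) ∧
    r - l = 1

end Hill

/-! With `A' = a - m`, `m` the mean of `a` and `μ = λ + m`, the quasi-derivative `p = u' + A u`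
turns `u'' + (a + λ) u = 0` into a linear system with continuous coefficients, so classical ODE
theory applies. Since `A` vanishes at 0 and 1, `p` and `u'` agree there and boundary conditions are
unaffected.

Let `φ`, `ψ` have initial values (1, 0), (0, 1), let `Δ = φ(1) + ψ'(1)`, and let `χ = ψ(1) φ - φ(1)
ψ` be the solution vanishing at 1. The monodromy matrix has determinant 1, so periodic eigenvalues
are the roots of `Δ = 2` (`exists_periodic_iff`). For very negative `λ`, `Δ > 2` and `ψ > 0` on (0,
1]. At the first `λ` where `ψ > 0` fails, `ψ` vanishes at 1 with negative slope, so the Wronskian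
forces `Δ < 0`. Hence `Δ = 2` has a least root, and below it `Δ > 2` and `ψ > 0` persist
(`exists_isLeast_discriminant`).

There `χ > 0` on (0, 1), and `ψ(1) G_D = -ψ(min(t,s)) χ(max(t,s)) < 0`. The jumps cancel in `G_P -
G_D`, a solution with equal end values `α`, so `ψ(1) (G_P - G_D) = α (χ(t) + ψ(t))`. The periodic
conditions give `α (2 - Δ) = χ(s) + ψ(s) > 0`, whence `α < 0` (`green_lt`). -/

namespace Hill

/-! ### The quasi-derivative system: existence and continuous dependence. -/

/-- The first order system obtained from `u'' + (A' + μ) u = 0` with the quasi-derivative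
`p = u' + A u`. -/
def IsSystemSol (A : ℝ → ℝ) (μ : ℝ) (u p : ℝ → ℝ) (c d : ℝ) : Prop :=
  ∀ t ∈ Icc c d, HasDerivWithinAt u (p t - A t * u t) (Icc c d) t ∧
    HasDerivWithinAt p (-(μ + A t ^ 2) * u t + A t * p t) (Icc c d) t

/-- The vector field of the system, with `x = (u, p)`. -/
def field (A : ℝ → ℝ) (μ t : ℝ) (x : ℝ × ℝ) : ℝ × ℝ :=
  (x.2 - A t * x.1, -(μ + A t ^ 2) * x.1 + A t * x.2)

theorem field_sub (A : ℝ → ℝ) (μ t : ℝ) (x y : ℝ × ℝ) :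
    field A μ t x - field A μ t y = field A μ t (x - y) := by
  ext <;> simp [field] <;> ring

theorem norm_field_le {A : ℝ → ℝ} {μ t M N : ℝ} (hM : |A t| ≤ M) (hN : |μ| ≤ N) (x : ℝ × ℝ) :
    ‖field A μ t x‖ ≤ (1 + M + N + M ^ 2) * ‖x‖ := by
  have h1 : |x.1| ≤ ‖x‖ := norm_fst_le x
  have h2 : |x.2| ≤ ‖x‖ := norm_snd_le x
  have hM0 : 0 ≤ M := (abs_nonneg _).trans hM
  have hN0 : 0 ≤ N := (abs_nonneg _).trans hN
  have h0 := norm_nonneg x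
  have hAA : |A t ^ 2| ≤ M ^ 2 := by rw [abs_pow]; gcongr
  have hAx1 : |A t * x.1| ≤ M * ‖x‖ := by rw [abs_mul]; gcongr
  have hAx2 : |A t * x.2| ≤ M * ‖x‖ := by rw [abs_mul]; gcongr
  have hmx : |-(μ + A t ^ 2) * x.1| ≤ (N + M ^ 2) * ‖x‖ := by
    rw [abs_mul, abs_neg]
    gcongr
    exact (abs_add_le _ _).trans (add_le_add hN hAA)
  have hp : 0 ≤ (N + M ^ 2) * ‖x‖ := by positivity
  rw [Prod.norm_def]
  refine max_le ?_ ?_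
  · have := abs_sub (x.2) (A t * x.1)
    simp only [field, Real.norm_eq_abs]
    nlinarith
  · have := abs_add_le (-(μ + A t ^ 2) * x.1) (A t * x.2)
    simp only [field, Real.norm_eq_abs]
    nlinarith

theorem field_lipschitz {A : ℝ → ℝ} {μ t M N : ℝ} (hM : |A t| ≤ M) (hN : |μ| ≤ N) :
    LipschitzWith (Real.toNNReal (1 + M + N + M ^ 2)) (field A μ t) := by
  have hM0 : 0 ≤ M := (abs_nonneg _).trans hM
  have hN0 : 0 ≤ N := (abs_nonneg _).trans hN
  refine LipschitzWith.of_dist_le_mul fun x y => ?_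
  rw [Real.coe_toNNReal _ (by positivity), dist_eq_norm, dist_eq_norm, field_sub]
  exact norm_field_le hM hN _

theorem isSystemSol_iff {A : ℝ → ℝ} {μ : ℝ} {u p : ℝ → ℝ} {c d : ℝ} :
    IsSystemSol A μ u p c d ↔ ∀ t ∈ Icc c d,
      HasDerivWithinAt (fun t => (u t, p t)) (field A μ t (u t, p t)) (Icc c d) t := by
  refine forall₂_congr fun t _ => ⟨fun h => h.1.prodMk h.2, fun h => ⟨?_, ?_⟩⟩
  · exact h.fst
  · exact h.snd

theorem IsSystemSol.continuousOn_prod {A : ℝ → ℝ} {μ : ℝ} {u p : ℝ → ℝ} {c d : ℝ}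
    (h : IsSystemSol A μ u p c d) : ContinuousOn (fun t => (u t, p t)) (Icc c d) :=
  fun t ht => (isSystemSol_iff.1 h t ht).continuousWithinAt

/-- Truncation of both coordinates to `[-R, R]`. -/
def clip (R : ℝ) (x : ℝ × ℝ) : ℝ × ℝ := (max (-R) (min R x.1), max (-R) (min R x.2))

theorem norm_clip_sub_le (R : ℝ) (x y : ℝ × ℝ) : ‖clip R x - clip R y‖ ≤ ‖x - y‖ := by
  have key : ∀ a b : ℝ, |max (-R) (min R a) - max (-R) (min R b)| ≤ |a - b| := fun a b => by
    grind
  rw [Prod.norm_def, Prod.norm_def]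
  exact max_le_max (key _ _) (key _ _)

theorem norm_clip_le {R : ℝ} (hR : 0 ≤ R) (x : ℝ × ℝ) : ‖clip R x‖ ≤ R := by
  have key : ∀ a : ℝ, |max (-R) (min R a)| ≤ R := fun a => by grind
  rw [Prod.norm_def]
  exact max_le (key _) (key _)

theorem clip_zero {R : ℝ} (hR : 0 ≤ R) : clip R 0 = 0 := by
  simp [clip, hR]

theorem clip_of_norm_le {R : ℝ} {x : ℝ × ℝ} (hx : ‖x‖ ≤ R) : clip R x = x := by
  have h1 : |x.1| ≤ R := (norm_fst_le x).trans hx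
  have h2 : |x.2| ≤ R := (norm_snd_le x).trans hx
  rw [abs_le] at h1 h2
  ext
  · simp [clip, h1]
  · simp [clip, h2]

/-- Clipping the state makes the field bounded, so Picard–Lindelöf covers all of [0, 1] in one step;
Grönwall then shows that the clip is never active. -/
theorem exists_isSystemSol {A : ℝ → ℝ} (hA : ContinuousOn A (Icc 0 1)) (μ u₀ p₀ : ℝ) :
    ∃ u p : ℝ → ℝ, IsSystemSol A μ u p 0 1 ∧ u 0 = u₀ ∧ p 0 = p₀ := by
  obtain ⟨M, hM⟩ := isCompact_Icc.exists_bound_of_continuousOn hA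
  have hM0 : 0 ≤ M := (norm_nonneg _).trans (hM 0 (by simp))
  set K : ℝ := 1 + M + |μ| + M ^ 2 with hK
  have hK0 : 0 ≤ K := by positivity
  set x₀ : ℝ × ℝ := (u₀, p₀)
  -- The Grönwall bound on [0, 1] for growth rate `K`.
  set R : ℝ := ‖x₀‖ * Real.exp K with hR
  have hR0 : 0 ≤ R := by positivity
  set f : ℝ → ℝ × ℝ → ℝ × ℝ := fun t x => field A μ t (clip R x) with hf
  have hfb : ∀ t ∈ Icc (0 : ℝ) 1, ∀ x, ‖f t x‖ ≤ K * ‖clip R x‖ := fun t ht x =>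
    norm_field_le (hM t ht) le_rfl _
  have hPL : IsPicardLindelof f (⟨0, by simp⟩ : Icc (0 : ℝ) 1) x₀ (Real.toNNReal (K * R)) 0
      (Real.toNNReal (K * R)) (Real.toNNReal K) := by
    refine ⟨fun t ht => ?_, fun x _ => ?_, fun t ht x _ => ?_, ?_⟩
    · refine (LipschitzWith.of_dist_le_mul fun x y => ?_).lipschitzOnWith
      rw [Real.coe_toNNReal _ hK0, dist_eq_norm, dist_eq_norm, field_sub]
      exact (norm_field_le (hM t ht) le_rfl _).trans
        (mul_le_mul_of_nonneg_left (norm_clip_sub_le _ _ _) hK0)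
    · simp only [hf, field]
      fun_prop
    · rw [Real.coe_toNNReal _ (by positivity)]
      exact (hfb t ht x).trans (mul_le_mul_of_nonneg_left (norm_clip_le hR0 _) hK0)
    · simp
  obtain ⟨α, hα0, hα⟩ := hPL.exists_eq_forall_mem_Icc_hasDerivWithinAt₀
  have hcont : ContinuousOn α (Icc 0 1) := fun t ht => (hα t ht).continuousWithinAt
  have hbound : ∀ t ∈ Icc (0 : ℝ) 1, ‖α t‖ ≤ R := by
    intro t ht
    have h := norm_le_gronwallBound_of_norm_deriv_right_le (δ := ‖x₀‖) (K := K) (ε := 0) hcont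
      (fun t ht => (hα t (Ico_subset_Icc_self ht)).mono_of_mem_nhdsWithin
        (Icc_mem_nhdsGE_of_mem ht)) (by rw [← hα0]) (fun t ht => ?_) t ht
    · rw [gronwallBound_ε0, sub_zero] at h
      refine h.trans (mul_le_mul_of_nonneg_left (Real.exp_le_exp.2 ?_) (norm_nonneg _))
      nlinarith [ht.2]
    · rw [add_zero]
      refine (hfb t (Ico_subset_Icc_self ht) _).trans (mul_le_mul_of_nonneg_left ?_ hK0)
      simpa [clip_zero hR0] using norm_clip_sub_le R (α t) 0
  refine ⟨fun t => (α t).1, fun t => (α t).2, isSystemSol_iff.2 fun t ht => ?_, ?_, ?_⟩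
  · have h := hα t ht
    simp only [hf, clip_of_norm_le (hbound t ht)] at h
    exact h
  · exact congrArg Prod.fst hα0
  · exact congrArg Prod.snd hα0

/-- Solutions with fixed initial values depend continuously on the time and the parameter. -/
theorem continuousOn_isSystemSol {A : ℝ → ℝ} (hA : ContinuousOn A (Icc 0 1)) {u p : ℝ → ℝ → ℝ}
    (h : ∀ μ, IsSystemSol A μ (u μ) (p μ) 0 1) (hu : ∀ μ ν, u μ 0 = u ν 0)
    (hp : ∀ μ ν, p μ 0 = p ν 0) :
    ContinuousOn (fun x : ℝ × ℝ => (u x.1 x.2, p x.1 x.2)) (univ ×ˢ Icc 0 1) := by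
  obtain ⟨M, hM⟩ := isCompact_Icc.exists_bound_of_continuousOn hA
  have hM0 : 0 ≤ M := (norm_nonneg _).trans (hM 0 (by simp))
  rintro ⟨μ, t⟩ ⟨-, ht⟩
  obtain ⟨C, hC⟩ := isCompact_Icc.exists_bound_of_continuousOn (h μ).continuousOn_prod
  have hC0 : 0 ≤ C := (norm_nonneg _).trans (hC 0 (by simp))
  set K : ℝ := 1 + M + (|μ| + 1) + M ^ 2 with hK
  have hK0 : 0 ≤ K := by positivity
  have hright : ∀ {ν : ℝ}, ∀ s ∈ Ico (0 : ℝ) 1, HasDerivWithinAt (fun t => (u ν t, p ν t))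
      (field A ν s (u ν s, p ν s)) (Ici s) s := fun s hs =>
    (isSystemSol_iff.1 (h _) s (Ico_subset_Icc_self hs)).mono_of_mem_nhdsWithin
      (Icc_mem_nhdsGE_of_mem hs)
  have hd : ∀ ν, |ν - μ| ≤ 1 → ∀ s ∈ Icc (0 : ℝ) 1,
      dist (u ν s, p ν s) (u μ s, p μ s) ≤ gronwallBound 0 K (|ν - μ| * C) 1 := by
    intro ν hν s hs
    have hν' : |ν| ≤ |μ| + 1 := by
      have := abs_sub_abs_le_abs_sub ν μ
      linarith
    -- The `μ`-trajectory is an approximate solution of the `ν`-system with defect at most `|ν - μ|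
    -- C`.
    have hg := dist_le_of_approx_trajectories_ODE_of_mem (v := field A ν)
      (K := Real.toNNReal K) (s := fun _ => univ) (δ := 0) (εf := 0) (εg := |ν - μ| * C)
      (fun t ht => (field_lipschitz (hM t (Ico_subset_Icc_self ht)) hν').lipschitzOnWith)
      (h ν).continuousOn_prod hright (fun s _ => by simp)
      (fun _ _ => mem_univ _) (h μ).continuousOn_prod hright (fun s hs => ?_)
      (fun _ _ => mem_univ _) (by simp [hu ν μ, hp ν μ]) s hs
    · rw [Real.coe_toNNReal _ hK0, zero_add, sub_zero] at hg
      exact hg.trans (gronwallBound_mono le_rfl (by positivity) hK0 hs.2)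
    · have hc : |u μ s| ≤ C := (norm_fst_le (u μ s, p μ s)).trans (hC s (Ico_subset_Icc_self hs))
      have : field A μ s (u μ s, p μ s) - field A ν s (u μ s, p μ s) = (0, (ν - μ) * u μ s) := by
        ext <;> simp [field]; ring
      rw [dist_eq_norm, this, Prod.norm_def]
      simp only [norm_zero, Real.norm_eq_abs, abs_mul]
      exact max_le (by positivity) (by gcongr)
  rw [ContinuousWithinAt, tendsto_iff_dist_tendsto_zero]
  have h1 : Tendsto (fun x : ℝ × ℝ => gronwallBound 0 K (|x.1 - μ| * C) 1 +
      dist (u μ x.2, p μ x.2) (u μ t, p μ t)) (𝓝[univ ×ˢ Icc 0 1] (μ, t)) (𝓝 0) := by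
    have e1 : Tendsto (fun x : ℝ × ℝ => gronwallBound 0 K (|x.1 - μ| * C) 1)
        (𝓝[univ ×ˢ Icc 0 1] (μ, t)) (𝓝 0) := by
      have : Continuous fun x : ℝ × ℝ => gronwallBound 0 K (|x.1 - μ| * C) 1 :=
        (gronwallBound_continuous_ε 0 K 1).comp (by fun_prop)
      have := (this.tendsto (μ, t)).mono_left (nhdsWithin_le_nhds (s := univ ×ˢ Icc 0 1))
      simpa [gronwallBound_ε0_δ0] using this
    have e2 : Tendsto (fun x : ℝ × ℝ => dist (u μ x.2, p μ x.2) (u μ t, p μ t))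
        (𝓝[univ ×ˢ Icc 0 1] (μ, t)) (𝓝 0) := by
      rw [← tendsto_iff_dist_tendsto_zero]
      exact Tendsto.comp ((h μ).continuousOn_prod t ht) (tendsto_nhdsWithin_iff.2
        ⟨(continuous_snd.tendsto (μ, t)).mono_left nhdsWithin_le_nhds,
          eventually_mem_nhdsWithin.mono fun x hx => hx.2⟩)
    simpa using e1.add e2
  refine squeeze_zero' (Eventually.of_forall fun _ => dist_nonneg) ?_ h1
  have hnear : ∀ᶠ x : ℝ × ℝ in 𝓝[univ ×ˢ Icc 0 1] (μ, t), |x.1 - μ| < 1 := by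
    refine nhdsWithin_le_nhds (IsOpen.mem_nhds (isOpen_lt (by fun_prop) continuous_const) ?_)
    simp
  filter_upwards [hnear, eventually_mem_nhdsWithin] with x hx hx'
  exact (dist_triangle _ (u μ x.2, p μ x.2) _).trans
    (add_le_add (hd x.1 hx.le x.2 hx'.2) le_rfl)

end Hill

/-! ### Fundamental solutions and their Wronskian. -/

namespace Hill

/-- `(φ, P)` and `(ψ, Q)` solve the system on `[0, 1]` with initial values `(1, 0)`, `(0, 1)`. -/
structure IsFundamental (A : ℝ → ℝ) (μ : ℝ) (φ P ψ Q : ℝ → ℝ) : Prop where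
  sol_left : IsSystemSol A μ φ P 0 1
  sol_right : IsSystemSol A μ ψ Q 0 1
  left_zero : φ 0 = 1
  left_zero' : P 0 = 0
  right_zero : ψ 0 = 0
  right_zero' : Q 0 = 1

variable {A : ℝ → ℝ} {μ c d : ℝ} {u p v q φ P ψ Q : ℝ → ℝ}

theorem IsSystemSol.continuousOn (h : IsSystemSol A μ u p c d) : ContinuousOn u (Icc c d) :=
  fun t ht => (h t ht).1.continuousWithinAt

theorem IsSystemSol.continuousOn' (h : IsSystemSol A μ u p c d) : ContinuousOn p (Icc c d) :=
  fun t ht => (h t ht).2.continuousWithinAt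

theorem IsSystemSol.mono {c' d' : ℝ} (h : IsSystemSol A μ u p c d) (hcd : Icc c' d' ⊆ Icc c d) :
    IsSystemSol A μ u p c' d' :=
  fun t ht => ⟨(h t (hcd ht)).1.mono hcd, (h t (hcd ht)).2.mono hcd⟩

theorem IsSystemSol.linear_combination (hu : IsSystemSol A μ u p c d)
    (hv : IsSystemSol A μ v q c d) (α β : ℝ) :
    IsSystemSol A μ (fun t => α * u t + β * v t) (fun t => α * p t + β * q t) c d := by
  intro t ht
  refine ⟨(((hu t ht).1.const_mul α).add ((hv t ht).1.const_mul β)).congr_deriv ?_,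
    (((hu t ht).2.const_mul α).add ((hv t ht).2.const_mul β)).congr_deriv ?_⟩ <;> ring

/-- The Wronskian of two solutions is constant. -/
theorem IsSystemSol.wronskian_eq (hu : IsSystemSol A μ u p c d) (hv : IsSystemSol A μ v q c d)
    {t : ℝ} (ht : t ∈ Icc c d) : u t * q t - v t * p t = u c * q c - v c * p c := by
  refine constant_of_has_deriv_right_zero (f := fun t => u t * q t - v t * p t)
    ((hu.continuousOn.mul hv.continuousOn').sub (hv.continuousOn.mul hu.continuousOn'))
    (fun s hs => ?_) t ht
  have hs' := Ico_subset_Icc_self hs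
  have h := ((hu s hs').1.mul (hv s hs').2).sub ((hv s hs').1.mul (hu s hs').2)
  refine (h.mono_of_mem_nhdsWithin (Icc_mem_nhdsGE_of_mem hs)).congr_deriv ?_
  ring

theorem IsFundamental.wronskian (h : IsFundamental A μ φ P ψ Q) {t : ℝ} (ht : t ∈ Icc (0 : ℝ) 1) :
    φ t * Q t - ψ t * P t = 1 := by
  rw [h.sol_left.wronskian_eq h.sol_right ht, h.left_zero, h.left_zero', h.right_zero,
    h.right_zero']
  ring

theorem exists_isFundamental (hA : ContinuousOn A (Icc 0 1)) (μ : ℝ) :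
    ∃ φ P ψ Q : ℝ → ℝ, IsFundamental A μ φ P ψ Q := by
  obtain ⟨φ, P, h₁, h₂, h₃⟩ := exists_isSystemSol hA μ 1 0
  obtain ⟨ψ, Q, k₁, k₂, k₃⟩ := exists_isSystemSol hA μ 0 1
  exact ⟨φ, P, ψ, Q, h₁, k₁, h₂, h₃, k₂, k₃⟩

/-! ### Sign of solutions for very negative and for large parameters. -/

/-- If `μ + A² < 0`, then `u p` is strictly increasing along nonvanishing solutions. -/
theorem IsSystemSol.strictMonoOn_mul (h : IsSystemSol A μ u p 0 1)
    (hneg : ∀ t ∈ Icc (0 : ℝ) 1, μ + A t ^ 2 < 0)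
    (hne : ∀ t ∈ Icc (0 : ℝ) 1, u t ≠ 0 ∨ p t ≠ 0) :
    StrictMonoOn (fun t => u t * p t) (Icc 0 1) := by
  refine strictMonoOn_of_deriv_pos (convex_Icc 0 1) (h.continuousOn.mul h.continuousOn') ?_
  intro t ht
  rw [interior_Icc] at ht
  have ht' := Ioo_subset_Icc_self ht
  have hd := (((h t ht').1.mul (h t ht').2).hasDerivAt (Icc_mem_nhds ht.1 ht.2)).deriv
  have e : (fun t => u t * p t) = u * p := rfl
  rw [e, hd]
  have e' : (p t - A t * u t) * p t + u t * (-(μ + A t ^ 2) * u t + A t * p t) =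
    p t ^ 2 + (-(μ + A t ^ 2)) * u t ^ 2 := by ring
  rw [e']
  have h1 := hneg t ht'
  rcases hne t ht' with h2 | h2
  · have : 0 < -(μ + A t ^ 2) * u t ^ 2 := mul_pos (by linarith) (by positivity)
    nlinarith [sq_nonneg (p t)]
  · have : 0 < p t ^ 2 := by positivity
    nlinarith [sq_nonneg (u t), mul_nonneg (neg_nonneg.2 h1.le) (sq_nonneg (u t))]

theorem pos_of_continuousOn_of_ne_zero {f : ℝ → ℝ} (hf : ContinuousOn f (Icc 0 1))
    (h0 : 0 < f 0) (hne : ∀ t ∈ Icc (0 : ℝ) 1, f t ≠ 0) : ∀ t ∈ Icc (0 : ℝ) 1, 0 < f t := by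
  intro t ht
  by_contra! hlt
  obtain ⟨s, hs, hs0⟩ := intermediate_value_Icc' ht.1 (hf.mono (Icc_subset_Icc_right ht.2))
    (⟨hlt, h0.le⟩ : (0 : ℝ) ∈ Icc (f t) (f 0))
  exact hne s ⟨hs.1, hs.2.trans ht.2⟩ hs0

/-- The products `φ P` and `ψ Q` vanish at 0 and increase strictly, so no factor vanishes on (0, 1].
As `φ` and `Q` start at 1, they stay positive, and the other factors inherit the sign. -/
theorem IsFundamental.pos_of_neg (h : IsFundamental A μ φ P ψ Q)
    (hneg : ∀ t ∈ Icc (0 : ℝ) 1, μ + A t ^ 2 < 0) {t : ℝ} (ht : t ∈ Ioc (0 : ℝ) 1) :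
    0 < φ t ∧ 0 < P t ∧ 0 < ψ t ∧ 0 < Q t := by
  have hne₁ : ∀ t ∈ Icc (0 : ℝ) 1, φ t ≠ 0 ∨ P t ≠ 0 := by
    intro t ht
    by_contra! hc
    simpa [hc.1, hc.2] using h.wronskian ht
  have hne₂ : ∀ t ∈ Icc (0 : ℝ) 1, ψ t ≠ 0 ∨ Q t ≠ 0 := by
    intro t ht
    by_contra! hc
    simpa [hc.1, hc.2] using h.wronskian ht
  have hpos₁ : ∀ t ∈ Ioc (0 : ℝ) 1, 0 < φ t * P t := fun t ht => by
    simpa [h.left_zero'] using h.sol_left.strictMonoOn_mul hneg hne₁ (by simp)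
      (Ioc_subset_Icc_self ht) ht.1
  have hpos₂ : ∀ t ∈ Ioc (0 : ℝ) 1, 0 < ψ t * Q t := fun t ht => by
    simpa [h.right_zero] using h.sol_right.strictMonoOn_mul hneg hne₂ (by simp)
      (Ioc_subset_Icc_self ht) ht.1
  have hφ : 0 < φ t := by
    refine pos_of_continuousOn_of_ne_zero h.sol_left.continuousOn (by simp [h.left_zero])
      (fun s hs => ?_) t (Ioc_subset_Icc_self ht)
    rcases hs.1.eq_or_lt with rfl | hs0
    · simp [h.left_zero]
    · exact left_ne_zero_of_mul (hpos₁ s ⟨hs0, hs.2⟩).ne'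
  have hQ : 0 < Q t := by
    refine pos_of_continuousOn_of_ne_zero h.sol_right.continuousOn' (by simp [h.right_zero'])
      (fun s hs => ?_) t (Ioc_subset_Icc_self ht)
    rcases hs.1.eq_or_lt with rfl | hs0
    · simp [h.right_zero']
    · exact right_ne_zero_of_mul (hpos₂ s ⟨hs0, hs.2⟩).ne'
  exact ⟨hφ, pos_of_mul_pos_right (hpos₁ t ht) hφ.le, pos_of_mul_pos_left (hpos₂ t ht) hQ.le, hQ⟩

/-- At 1, `φ Q = 1 + ψ P > 1`, and `(φ + Q)² ≥ 4 φ Q`. -/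
theorem IsFundamental.two_lt_of_neg (h : IsFundamental A μ φ P ψ Q)
    (hneg : ∀ t ∈ Icc (0 : ℝ) 1, μ + A t ^ 2 < 0) : 2 < φ 1 + Q 1 := by
  obtain ⟨h₁, h₂, h₃, h₄⟩ := h.pos_of_neg hneg (t := 1) (by simp)
  have := h.wronskian (t := 1) (by simp)
  nlinarith [mul_pos h₂ h₃, sq_nonneg (φ 1 - Q 1)]

/-- For large `μ` no solution is positive on `(0, 1]`. -/
theorem IsSystemSol.exists_nonpos {M : ℝ} (hM : ∀ t ∈ Icc (0 : ℝ) 1, |A t| ≤ M)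
    (h : IsSystemSol A (M ^ 2 + 200) u p 0 1) : ∃ t ∈ Ioc (0 : ℝ) 1, u t ≤ 0 := by
  by_contra! hpos
  -- The point 0 is avoided because `u` may vanish there.
  have hsub : Icc (1 / 4 : ℝ) 1 ⊆ Icc 0 1 := Icc_subset_Icc_left (by norm_num)
  have hpos' : ∀ t ∈ Icc (1 / 4 : ℝ) 1, 0 < u t := fun t ht =>
    hpos t ⟨by linarith [ht.1], ht.2⟩
  -- A scaled Prüfer angle: `r = p / u` obeys the Riccati equation `r' = -(M² + 200) - (r - A)²`, so
  -- the angle falls at a rate of at least 10.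
  have hcont : ContinuousOn (fun t => Real.arctan (p t / u t / 20)) (Icc (1 / 4) 1) :=
    Real.continuous_arctan.comp_continuousOn (((h.continuousOn'.mono hsub).div
      (h.continuousOn.mono hsub) fun t ht => (hpos' t ht).ne').div_const 20)
  have hderiv : ∀ t ∈ Ioo (1 / 4 : ℝ) 1, ∃ r ≤ (-10 : ℝ),
      HasDerivAt (fun t => Real.arctan (p t / u t / 20)) r t := by
    intro t ht
    have ht' := Ioo_subset_Icc_self ht
    have hu := hpos' t ht'
    have hn : Icc (0 : ℝ) 1 ∈ 𝓝 t := Icc_mem_nhds (by linarith [ht.1]) ht.2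
    have hd := ((((h t (hsub ht')).2.hasDerivAt hn).div ((h t (hsub ht')).1.hasDerivAt hn)
      hu.ne').div_const 20).arctan
    refine ⟨_, ?_, hd⟩
    have hA : A t ^ 2 ≤ M ^ 2 := sq_le_sq' (by linarith [(abs_le.1 (hM t (hsub ht'))).1])
      (abs_le.1 (hM t (hsub ht'))).2
    simp only [Pi.div_apply]
    set r := p t / u t with hr
    have hp : p t = r * u t := by rw [hr]; field_simp
    have e : ((-(M ^ 2 + 200 + A t ^ 2) * u t + A t * p t) * u t -
        p t * (p t - A t * u t)) / u t ^ 2 = -(M ^ 2 + 200) - (r - A t) ^ 2 := by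
      rw [hp]
      field_simp
      ring
    rw [e, one_div, inv_mul_le_iff₀ (by positivity)]
    -- The claim amounts to `2 M² + 2 (r - A)² ≥ r²`; since `M² ≥ A²`, it follows from `(r - 2 A)² ≥
    -- 0`.
    nlinarith [sq_nonneg (r - 2 * A t)]
  have hle := (convex_Icc (1 / 4 : ℝ) 1).image_sub_le_mul_sub_of_deriv_le hcont
    (C := -10) (fun t ht => ?_) (fun t ht => ?_) (1 / 4) (by norm_num) 1 (by norm_num) (by norm_num)
  -- The angle drops by at least 7.5 on [1/4, 1], but its range has length `π < 4`.
  · have h1 := Real.neg_pi_div_two_lt_arctan (p 1 / u 1 / 20)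
    have h2 := Real.arctan_lt_pi_div_two (p (1 / 4) / u (1 / 4) / 20)
    have h3 := Real.pi_lt_four
    linarith
  · rw [interior_Icc] at ht
    obtain ⟨r, -, hd⟩ := hderiv t ht
    exact hd.differentiableAt.differentiableWithinAt
  · rw [interior_Icc] at ht
    obtain ⟨r, hr, hd⟩ := hderiv t ht
    rwa [hd.deriv]

/-- A solution that is nonnegative on `[0, 1]` and vanishes somewhere in `(0, 1]`, but not
together with its derivative, vanishes at `1` with negative slope there. -/
theorem IsFundamental.eq_zero_of_nonneg (h : IsFundamental A μ φ P ψ Q)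
    (hnonneg : ∀ t ∈ Icc (0 : ℝ) 1, 0 ≤ ψ t) {t : ℝ} (ht : t ∈ Ioc (0 : ℝ) 1) (hψ : ψ t = 0) :
    ψ 1 = 0 ∧ Q 1 < 0 := by
  have ht' := Ioc_subset_Icc_self ht
  have hQt : Q t ≠ 0 := by
    intro hc
    simpa [hc, hψ] using h.wronskian ht'
  have hd := (h.sol_right t ht').1
  rw [hψ, mul_zero, sub_zero] at hd
  have h1 : t = 1 := by
    by_contra hne
    have hn : Icc (0 : ℝ) 1 ∈ 𝓝 t := Icc_mem_nhds ht.1 (lt_of_le_of_ne ht.2 hne)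
    have hmin : IsLocalMin ψ t := by
      filter_upwards [hn] with s hs
      rw [hψ]
      exact hnonneg s hs
    exact hQt (hmin.hasDerivAt_eq_zero (hd.hasDerivAt hn))
  subst h1
  refine ⟨hψ, lt_of_le_of_ne ?_ hQt⟩
  have hd' : HasDerivWithinAt ψ (Q 1) (Iio 1) 1 :=
    hd.mono_of_mem_nhdsWithin (Icc_mem_nhdsLT one_pos)
  rw [hasDerivWithinAt_iff_tendsto_slope' (by simp)] at hd'
  refine le_of_tendsto hd' ?_
  filter_upwards [Ioo_mem_nhdsLT (show (0 : ℝ) < 1 by norm_num)] with s hs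
  rw [slope_def_field, hψ]
  exact div_nonpos_of_nonneg_of_nonpos (by linarith [hnonneg s (Ioo_subset_Icc_self hs)])
    (by linarith [hs.2])

/-! ### Varying the parameter: the least root of the discriminant equation. -/

theorem continuous_section {f : ℝ → ℝ → ℝ}
    (hf : ContinuousOn (fun x : ℝ × ℝ => f x.1 x.2) (univ ×ˢ Icc 0 1)) {t : ℝ}
    (ht : t ∈ Icc (0 : ℝ) 1) : Continuous fun μ => f μ t := by
  rw [← continuousOn_univ]
  exact hf.comp (f := fun μ : ℝ => (μ, t)) (by fun_prop) fun μ _ => ⟨mem_univ _, ht⟩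

theorem eventually_forall_pos {f : ℝ → ℝ → ℝ}
    (hf : ContinuousOn (fun x : ℝ × ℝ => f x.1 x.2) (univ ×ˢ Icc 0 1)) {μ c d : ℝ}
    (hcd : Icc c d ⊆ Icc 0 1) (hpos : ∀ t ∈ Icc c d, 0 < f μ t) :
    ∀ᶠ ν in 𝓝 μ, ∀ t ∈ Icc c d, 0 < f ν t := by
  have h := isCompact_Icc.eventually_forall_of_forall_eventually (x₀ := μ) (K := Icc c d)
    (P := fun ν t => t ∈ Icc (0 : ℝ) 1 → 0 < f ν t) fun t ht => by
      have := (hf (μ, t) ⟨mem_univ _, hcd ht⟩).eventually (lt_mem_nhds (hpos t ht))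
      rw [eventually_nhdsWithin_iff] at this
      exact this.mono fun x hx hx' => hx ⟨mem_univ _, hx'⟩
  exact h.mono fun ν hν t ht => hν t ht (hcd ht)

section Family

variable {φ P ψ Q : ℝ → ℝ → ℝ}

/-- Compactness alone fails because `ψ(0) = 0`. Near 0 the slope `Q - A ψ` is positive, and this
persists under perturbation on some [0, δ]; compactness handles [δ, 1]. -/
theorem isOpen_forall_pos (hA : ContinuousOn A (Icc 0 1))
    (h : ∀ μ, IsFundamental A μ (φ μ) (P μ) (ψ μ) (Q μ)) :
    IsOpen {μ | ∀ t ∈ Ioc (0 : ℝ) 1, 0 < ψ μ t} := by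
  have hc := continuousOn_isSystemSol hA (fun μ => (h μ).sol_right)
    (fun μ ν => by rw [(h μ).right_zero, (h ν).right_zero])
    (fun μ ν => by rw [(h μ).right_zero', (h ν).right_zero'])
  have hψ : ContinuousOn (fun x : ℝ × ℝ => ψ x.1 x.2) (univ ×ˢ Icc 0 1) :=
    continuous_fst.comp_continuousOn hc
  have hQ : ContinuousOn (fun x : ℝ × ℝ => Q x.1 x.2) (univ ×ˢ Icc 0 1) :=
    continuous_snd.comp_continuousOn hc
  have hA' : ContinuousOn (fun x : ℝ × ℝ => A x.2) (univ ×ˢ Icc 0 1) :=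
    hA.comp continuousOn_snd fun x hx => hx.2
  rw [isOpen_iff_mem_nhds]
  intro μ hμ
  have hF : ContinuousOn (fun t => Q μ t - A t * ψ μ t) (Icc 0 1) :=
    (h μ).sol_right.continuousOn'.sub (hA.mul (h μ).sol_right.continuousOn)
  obtain ⟨δ, hδ, hδ'⟩ : ∃ δ ∈ Ioc (0 : ℝ) 1, ∀ t ∈ Icc 0 δ, 0 < Q μ t - A t * ψ μ t := by
    have h0 := (hF 0 (by simp)).eventually (lt_mem_nhds (a := 0)
      (by simp [(h μ).right_zero, (h μ).right_zero']))
    rw [nhdsWithin_Icc_eq_nhdsGE one_pos, nhdsGE_basis_Icc.eventually_iff] at h0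
    obtain ⟨ε, hε, hε'⟩ := h0
    refine ⟨min ε 1, ⟨lt_min hε one_pos, min_le_right _ _⟩, fun t ht => hε' ?_⟩
    exact ⟨ht.1, ht.2.trans (min_le_left _ _)⟩
  have h1 := eventually_forall_pos (f := fun ν t => Q ν t - A t * ψ ν t) (hQ.sub (hA'.mul hψ))
    (Icc_subset_Icc_right hδ.2) hδ'
  have h2 := eventually_forall_pos hψ (μ := μ) (Icc_subset_Icc_left hδ.1.le) fun t ht =>
    hμ t ⟨hδ.1.trans_le ht.1, ht.2⟩
  filter_upwards [h1, h2] with ν h1 h2 t ht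
  rcases le_total δ t with hδt | htδ
  · exact h2 t ⟨hδt, ht.2⟩
  · have hmono : StrictMonoOn (ψ ν) (Icc 0 δ) := by
      refine strictMonoOn_of_deriv_pos (convex_Icc 0 δ)
        ((h ν).sol_right.continuousOn.mono (Icc_subset_Icc_right hδ.2)) fun s hs => ?_
      rw [interior_Icc] at hs
      have hs' := Ioo_subset_Icc_self hs
      rw [(((h ν).sol_right s (Icc_subset_Icc_right hδ.2 hs')).1.hasDerivAt
        (Icc_mem_nhds hs.1 (hs.2.trans_le hδ.2))).deriv]
      exact h1 s hs'
    simpa [(h ν).right_zero] using hmono (by simp [hδ.1.le]) ⟨ht.1.le, htδ⟩ ht.1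

/-- The discriminant equation `φ 1 + Q 1 = 2` has a least root; below it the discriminant is
larger than `2` and the equation is disconjugate on `[0, 1]`. -/
theorem exists_isLeast_discriminant (hA : ContinuousOn A (Icc 0 1))
    (h : ∀ μ, IsFundamental A μ (φ μ) (P μ) (ψ μ) (Q μ)) :
    ∃ μ₀, IsLeast {μ | φ μ 1 + Q μ 1 = 2} μ₀ ∧
      ∀ μ < μ₀, 2 < φ μ 1 + Q μ 1 ∧ ∀ t ∈ Ioc (0 : ℝ) 1, 0 < ψ μ t := by
  obtain ⟨M, hM⟩ := isCompact_Icc.exists_bound_of_continuousOn hA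
  have hneg : ∀ μ < -M ^ 2, ∀ t ∈ Icc (0 : ℝ) 1, μ + A t ^ 2 < 0 := by
    intro μ hμ t ht
    have := sq_le_sq' (by linarith [(abs_le.1 (hM t ht)).1]) (abs_le.1 (hM t ht)).2
    linarith
  have hcφ := continuousOn_isSystemSol hA (fun μ => (h μ).sol_left)
    (fun μ ν => by rw [(h μ).left_zero, (h ν).left_zero])
    (fun μ ν => by rw [(h μ).left_zero', (h ν).left_zero'])
  have hcψ := continuousOn_isSystemSol hA (fun μ => (h μ).sol_right)
    (fun μ ν => by rw [(h μ).right_zero, (h ν).right_zero])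
    (fun μ ν => by rw [(h μ).right_zero', (h ν).right_zero'])
  have hφ : ContinuousOn (fun x : ℝ × ℝ => φ x.1 x.2) (univ ×ˢ Icc 0 1) :=
    continuous_fst.comp_continuousOn hcφ
  have hψ : ContinuousOn (fun x : ℝ × ℝ => ψ x.1 x.2) (univ ×ˢ Icc 0 1) :=
    continuous_fst.comp_continuousOn hcψ
  have hQ : ContinuousOn (fun x : ℝ × ℝ => Q x.1 x.2) (univ ×ˢ Icc 0 1) :=
    continuous_snd.comp_continuousOn hcψ
  have hΔ : Continuous fun μ => φ μ 1 + Q μ 1 :=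
    (continuous_section hφ (by simp)).add (continuous_section hQ (by simp))
  set S : Set ℝ := {μ | ∀ t ∈ Ioc (0 : ℝ) 1, 0 < ψ μ t}ᶜ with hS
  have hSclosed : IsClosed S := (isOpen_forall_pos hA h).isClosed_compl
  have hSne : S.Nonempty := by
    refine ⟨M ^ 2 + 200, fun hc => ?_⟩
    obtain ⟨t, ht, ht'⟩ := (h (M ^ 2 + 200)).sol_right.exists_nonpos hM
    exact absurd (hc t ht) ht'.not_gt
  have hSlb : ∀ μ ∈ S, -M ^ 2 ≤ μ := by
    intro μ hμ
    by_contra! hlt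
    exact hμ fun t ht => ((h μ).pos_of_neg (hneg μ hlt) ht).2.2.1
  -- The first parameter at which positivity of `ψ` on (0, 1] is lost.
  set μ₁ := sInf S
  have hμ₁ : μ₁ ∈ S := hSclosed.csInf_mem hSne ⟨_, hSlb⟩
  have hlt₁ : ∀ μ < μ₁, ∀ t ∈ Ioc (0 : ℝ) 1, 0 < ψ μ t := fun μ hμ => by
    simpa [hS] using notMem_of_lt_csInf hμ ⟨_, hSlb⟩
  have hnonneg : ∀ t ∈ Icc (0 : ℝ) 1, 0 ≤ ψ μ₁ t := by
    intro t ht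
    rcases ht.1.eq_or_lt with rfl | h0
    · simp [(h μ₁).right_zero]
    · refine ge_of_tendsto (((continuous_section hψ ht).tendsto μ₁).mono_left
        (nhdsWithin_le_nhds (s := Iio μ₁))) ?_
      filter_upwards [self_mem_nhdsWithin] with μ hμ using (hlt₁ μ hμ t ⟨h0, ht.2⟩).le
  -- Here `ψ(1) = 0` and `Q(1) < 0`, so `φ(1) Q(1) = 1` makes `φ(1)` negative too.
  have hΔ₁ : φ μ₁ 1 + Q μ₁ 1 < 2 := by
    simp only [hS, mem_compl_iff, mem_ofPred_eq] at hμ₁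
    push Not at hμ₁
    obtain ⟨t, ht, ht'⟩ := hμ₁
    obtain ⟨h1, h2⟩ := (h μ₁).eq_zero_of_nonneg hnonneg ht
      (le_antisymm ht' (hnonneg t (Ioc_subset_Icc_self ht)))
    have := (h μ₁).wronskian (t := 1) (by simp)
    rw [h1, zero_mul, sub_zero] at this
    nlinarith
  have hDlb : ∀ μ ∈ {μ | φ μ 1 + Q μ 1 = 2}, -M ^ 2 ≤ μ := by
    intro μ hμ
    by_contra! hlt
    exact ((h μ).two_lt_of_neg (hneg μ hlt)).ne' hμ
  -- The discriminant exceeds 2 far to the left, so the intermediate value theorem gives a root at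
  -- or below `μ`. This locates a root at or below `μ₁` and later excludes values at most 2 below
  -- the least root.
  have hroot : ∀ μ, φ μ 1 + Q μ 1 ≤ 2 → ∃ ν ≤ μ, φ ν 1 + Q ν 1 = 2 := by
    intro μ hμ
    have hmin : min μ (-M ^ 2) - 1 < -M ^ 2 := by linarith [min_le_right μ (-M ^ 2)]
    obtain ⟨ν, hν, hν'⟩ := intermediate_value_Icc'
      (show min μ (-M ^ 2) - 1 ≤ μ by linarith [min_le_left μ (-M ^ 2)])
      hΔ.continuousOn (⟨hμ, ((h _).two_lt_of_neg (hneg _ hmin)).le⟩ : (2 : ℝ) ∈ Icc _ _)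
    exact ⟨ν, hν.2, hν'⟩
  obtain ⟨ν, hν, hν'⟩ := hroot μ₁ hΔ₁.le
  have hleast : IsLeast {μ | φ μ 1 + Q μ 1 = 2} (sInf {μ | φ μ 1 + Q μ 1 = 2}) :=
    (isClosed_eq hΔ continuous_const).isLeast_csInf ⟨ν, hν'⟩ ⟨_, hDlb⟩
  refine ⟨_, hleast, fun μ hμ => ⟨?_, hlt₁ μ (hμ.trans_le ((hleast.2 hν').trans hν))⟩⟩
  by_contra! hle
  obtain ⟨ξ, hξ, hξ'⟩ := hroot μ hle
  exact absurd (hleast.2 hξ') (not_le.2 (hξ.trans_lt hμ))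

end Family

end Hill

/-! ### Equivalence of the system with the equation in `W^{2,1}`. -/

namespace Hill

theorem _root_.AbsolutelyContinuousOnInterval.congr {f g : ℝ → ℝ} {c d : ℝ}
    (hf : AbsolutelyContinuousOnInterval f c d) (hfg : EqOn f g (uIcc c d)) :
    AbsolutelyContinuousOnInterval g c d := by
  rw [absolutelyContinuousOnInterval_iff] at hf ⊢
  intro ε hε
  obtain ⟨δ, hδ, h⟩ := hf ε hε
  refine ⟨δ, hδ, fun E hE hE' => ?_⟩
  refine lt_of_eq_of_lt (Finset.sum_congr rfl fun i hi => ?_) (h E hE hE')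
  rw [hfg (hE.1 i hi).1, hfg (hE.1 i hi).2]

theorem contDiffOn_one_Icc {f f' : ℝ → ℝ} {c d : ℝ} (hcd : c < d)
    (hf : ∀ t ∈ Icc c d, HasDerivWithinAt f (f' t) (Icc c d) t) (hf' : ContinuousOn f' (Icc c d)) :
    ContDiffOn ℝ 1 f (Icc c d) := by
  rw [contDiffOn_one_iff_derivWithin (uniqueDiffOn_Icc hcd)]
  exact ⟨fun t ht => (hf t ht).differentiableWithinAt,
    hf'.congr fun t ht => (hf t ht).derivWithin (uniqueDiffOn_Icc hcd t ht)⟩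

variable {b : ℝ → ℝ} {μ c d : ℝ} {u p φ P ψ Q : ℝ → ℝ}

theorem absolutelyContinuous_primitive (hb : IntervalIntegrable b volume 0 1) (hc : 0 ≤ c)
    (hcd : c < d) (hd : d ≤ 1) :
    AbsolutelyContinuousOnInterval (fun t => ∫ x in (0)..t, b x) c d :=
  (hb.absolutelyContinuousOnInterval_intervalIntegral (by simp)).mono (by
    rw [uIcc_of_le hcd.le, uIcc_of_le zero_le_one]
    exact Icc_subset_Icc hc hd)

theorem continuousOn_primitive (hb : IntervalIntegrable b volume 0 1) :
    ContinuousOn (fun t => ∫ x in (0)..t, b x) (Icc 0 1) := by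
  simpa [uIcc_of_le] using
    (absolutelyContinuous_primitive hb le_rfl one_pos le_rfl).continuousOn

theorem ae_hasDerivAt_primitive (hb : IntervalIntegrable b volume 0 1) (hc : 0 ≤ c)
    (hd : d ≤ 1) :
    ∀ᵐ t ∂(volume.restrict (Icc c d)), t ∈ Ioo c d ∧
      HasDerivAt (fun t => ∫ x in (0)..t, b x) (b t) t := by
  rw [ae_restrict_iff' measurableSet_Icc]
  have h₁ : ∀ᵐ x : ℝ, x ≠ c := by simp [ae_iff, measure_singleton]
  have h₂ : ∀ᵐ x : ℝ, x ≠ d := by simp [ae_iff, measure_singleton]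
  filter_upwards [h₁, h₂, hb.ae_hasDerivAt_integral] with t h1 h2 h3 ht
  refine ⟨⟨lt_of_le_of_ne ht.1 h1.symm, lt_of_le_of_ne ht.2 h2⟩, h3 ?_ 0 (by simp)⟩
  rw [uIcc_of_le zero_le_one]
  exact ⟨hc.trans ht.1, ht.2.trans hd⟩

theorem IsSystemSol.derivWithin_eq {A : ℝ → ℝ} (h : IsSystemSol A μ u p c d) (hcd : c < d) {t : ℝ}
    (ht : t ∈ Icc c d) : derivWithin u (Icc c d) t = p t - A t * u t :=
  (h t ht).1.derivWithin (uniqueDiffOn_Icc hcd t ht)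

theorem IsSystemSol.solvesOn (hb : IntervalIntegrable b volume 0 1) (hc : 0 ≤ c) (hcd : c < d)
    (hd : d ≤ 1) (h : IsSystemSol (fun t => ∫ x in (0)..t, b x) μ u p c d) :
    SolvesOn (fun t => b t + μ) u c d := by
  have hAc : ContinuousOn (fun t => ∫ x in (0)..t, b x) (Icc c d) :=
    (continuousOn_primitive hb).mono (Icc_subset_Icc hc hd)
  have hA := absolutelyContinuous_primitive hb hc hcd hd
  have huc := h.continuousOn
  have hpc := h.continuousOn'
  set A : ℝ → ℝ := fun t => ∫ x in (0)..t, b x with hAdef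
  have hu : AbsolutelyContinuousOnInterval u c d := by
    refine ContDiffOn.absolutelyContinuousOnInterval ?_
    rw [uIcc_of_le hcd.le]
    exact contDiffOn_one_Icc hcd (fun t ht => (h t ht).1) (hpc.sub (hAc.mul huc))
  have hp : AbsolutelyContinuousOnInterval p c d := by
    refine ContDiffOn.absolutelyContinuousOnInterval ?_
    rw [uIcc_of_le hcd.le]
    exact contDiffOn_one_Icc hcd (fun t ht => (h t ht).2)
      (((continuousOn_const.add (hAc.pow 2)).neg.mul huc).add (hAc.mul hpc))
  refine ⟨fun t ht => (h t ht).1.differentiableWithinAt, ?_, ?_⟩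
  · refine (hp.sub (hA.mul hu)).congr fun t ht => ?_
    rw [uIcc_of_le hcd.le] at ht
    rw [h.derivWithin_eq hcd ht]
    rfl
  · filter_upwards [ae_hasDerivAt_primitive hb hc hd] with t ht
    have hn : Icc c d ∈ 𝓝 t := Icc_mem_nhds ht.1.1 ht.1.2
    have ht' := Ioo_subset_Icc_self ht.1
    have hder := ((h t ht').2.hasDerivAt hn).sub (ht.2.mul ((h t ht').1.hasDerivAt hn))
    refine (hder.congr_of_eventuallyEq ?_).congr_deriv ?_
    · filter_upwards [hn] with s hs using h.derivWithin_eq hcd hs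
    · ring

/-- The quasi-derivative is absolutely continuous, and the singular term `b u` cancels from its
derivative, which equals the continuous function `-μ u + A u'` almost everywhere. So it differs from
a primitive of that function by a constant, and the system holds at every point. -/
theorem SolvesOn.isSystemSol (hb : IntervalIntegrable b volume 0 1) (hc : 0 ≤ c) (hcd : c < d)
    (hd : d ≤ 1) (h : SolvesOn (fun t => b t + μ) u c d) :
    IsSystemSol (fun t => ∫ x in (0)..t, b x) μ u
      (fun t => derivWithin u (Icc c d) t + (∫ x in (0)..t, b x) * u t) c d := by
  obtain ⟨hdiff, hv, hae⟩ := h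
  have hAc : ContinuousOn (fun t => ∫ x in (0)..t, b x) (Icc c d) :=
    (continuousOn_primitive hb).mono (Icc_subset_Icc hc hd)
  have hA := absolutelyContinuous_primitive hb hc hcd hd
  have hAder := ae_hasDerivAt_primitive hb hc hd
  set A : ℝ → ℝ := fun t => ∫ x in (0)..t, b x with hAdef
  set v := derivWithin u (Icc c d)
  have hud : ∀ t ∈ Icc c d, HasDerivWithinAt u (v t) (Icc c d) t := fun t ht =>
    (hdiff t ht).hasDerivWithinAt
  have hvc : ContinuousOn v (Icc c d) := by simpa [uIcc_of_le hcd.le] using hv.continuousOn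
  have hu : AbsolutelyContinuousOnInterval u c d := by
    refine ContDiffOn.absolutelyContinuousOnInterval ?_
    rw [uIcc_of_le hcd.le]
    exact contDiffOn_one_Icc hcd hud hvc
  set g : ℝ → ℝ := fun t => -μ * u t + A t * v t with hg
  have hgc : ContinuousOn g (Icc c d) :=
    (continuousOn_const.mul hdiff.continuousOn).add (hAc.mul hvc)
  -- Extending `g` by constants outside [c, d] makes its primitive differentiable at the end points
  -- as well.
  have hGd : ∀ t, HasDerivAt (fun t => ∫ x in c..t, IccExtend hcd.le ((Icc c d).domRestrict g) x)
      (IccExtend hcd.le ((Icc c d).domRestrict g) t) t := fun t =>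
    (hgc.domRestrict.Icc_extend').integral_hasStrictDerivAt c t |>.hasDerivAt
  have hGd' : ∀ t ∈ Icc c d,
      HasDerivAt (fun t => ∫ x in c..t, IccExtend hcd.le ((Icc c d).domRestrict g) x) (g t) t :=
    fun t ht => by
      have := hGd t
      rwa [IccExtend_of_mem _ _ ht] at this
  set G : ℝ → ℝ := fun t => ∫ x in c..t, IccExtend hcd.le ((Icc c d).domRestrict g) x
  have hG : AbsolutelyContinuousOnInterval G c d := by
    refine ContDiffOn.absolutelyContinuousOnInterval ?_
    rw [uIcc_of_le hcd.le]
    exact contDiffOn_one_Icc hcd (fun t ht => (hGd' t ht).hasDerivWithinAt) hgc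
  obtain ⟨C, hC⟩ := ((hv.add (hA.mul hu)).sub hG).const_of_ae_hasDerivAt_zero (by
    rw [uIcc_of_le hcd.le, ← ae_restrict_iff' measurableSet_Icc]
    filter_upwards [hAder, hae] with t ht ht'
    have hmem := Ioo_subset_Icc_self ht.1
    have hn : Icc c d ∈ 𝓝 t := Icc_mem_nhds ht.1.1 ht.1.2
    refine ((ht'.add (ht.2.mul ((hud t hmem).hasDerivAt hn))).sub (hGd' t hmem)).congr_deriv ?_
    simp only [hg]
    ring)
  rw [uIcc_of_le hcd.le] at hC
  have hpG : ∀ t ∈ Icc c d, v t + A t * u t = G t + C := fun t ht => by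
    have := hC t ht
    simp only [Pi.sub_apply, Pi.add_apply, Pi.mul_apply] at this
    linarith
  refine fun t ht => ⟨(hud t ht).congr_deriv (by simp [hAdef]), ?_⟩
  refine (((hGd' t ht).add_const C).hasDerivWithinAt.congr hpG (hpG t ht)).congr_deriv ?_
  simp only [hg, hAdef]
  ring

/-! ### Solution bases and periodic eigenvalues. -/

/-- The functions `φ`, `ψ` are the solutions of `u'' + q u = 0` on `[0, 1]` with initial values
`(1, 0)`, `(0, 1)`, and `φ'`, `ψ'` are their derivatives. -/
structure IsSolutionBasis (q φ φ' ψ ψ' : ℝ → ℝ) : Prop where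
  hasDeriv_left : ∀ t ∈ Icc (0 : ℝ) 1, HasDerivWithinAt φ (φ' t) (Icc 0 1) t
  hasDeriv_right : ∀ t ∈ Icc (0 : ℝ) 1, HasDerivWithinAt ψ (ψ' t) (Icc 0 1) t
  continuousOn_left : ContinuousOn φ' (Icc 0 1)
  continuousOn_right : ContinuousOn ψ' (Icc 0 1)
  left_zero : φ 0 = 1
  left_zero' : φ' 0 = 0
  right_zero : ψ 0 = 0
  right_zero' : ψ' 0 = 1
  wronskian : ∀ t ∈ Icc (0 : ℝ) 1, φ t * ψ' t - ψ t * φ' t = 1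
  solvesOn : ∀ α β c d : ℝ, 0 ≤ c → c < d → d ≤ 1 → SolvesOn q (fun t => α * φ t + β * ψ t) c d
  exists_eq : ∀ (u : ℝ → ℝ) (c d : ℝ), 0 ≤ c → c < d → d ≤ 1 → SolvesOn q u c d →
    ∃ α β : ℝ, ∀ t ∈ Icc c d, u t = α * φ t + β * ψ t ∧
      derivWithin u (Icc c d) t = α * φ' t + β * ψ' t

theorem IsFundamental.isSolutionBasis (hb : IntervalIntegrable b volume 0 1)
    (h : IsFundamental (fun t => ∫ x in (0)..t, b x) μ φ P ψ Q) :
    IsSolutionBasis (fun t => b t + μ) φ (fun t => P t - (∫ x in (0)..t, b x) * φ t) ψ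
      (fun t => Q t - (∫ x in (0)..t, b x) * ψ t) where
  hasDeriv_left t ht := (h.sol_left t ht).1
  hasDeriv_right t ht := (h.sol_right t ht).1
  continuousOn_left :=
    h.sol_left.continuousOn'.sub ((continuousOn_primitive hb).mul h.sol_left.continuousOn)
  continuousOn_right :=
    h.sol_right.continuousOn'.sub ((continuousOn_primitive hb).mul h.sol_right.continuousOn)
  left_zero := h.left_zero
  left_zero' := by simp [h.left_zero']
  right_zero := h.right_zero
  right_zero' := by simp [h.right_zero']
  wronskian t ht := by
    rw [← h.wronskian ht]
    ring
  solvesOn α β c d hc hcd hd :=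
    ((h.sol_left.linear_combination h.sol_right α β).mono (Icc_subset_Icc hc hd)).solvesOn
      hb hc hcd hd
  exists_eq u c d hc hcd hd hu := by
    have hs := hu.isSystemSol hb hc hcd hd
    have hsub := Icc_subset_Icc hc hd
    set A : ℝ → ℝ := fun t => ∫ x in (0)..t, b x
    set p : ℝ → ℝ := fun t => derivWithin u (Icc c d) t + A t * u t with hp
    have h₁ := fun t (ht : t ∈ Icc c d) => hs.wronskian_eq (h.sol_right.mono hsub) ht
    have h₂ := fun t (ht : t ∈ Icc c d) => hs.wronskian_eq (h.sol_left.mono hsub) ht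
    refine ⟨u c * Q c - ψ c * p c, -(u c * P c - φ c * p c), fun t ht => ?_⟩
    have hW := h.wronskian (hsub ht)
    have e : derivWithin u (Icc c d) t = p t - A t * u t := by simp [hp, A]
    rw [← h₁ t ht, ← h₂ t ht, e]
    constructor
    · linear_combination (-u t) * hW
    · linear_combination (A t * u t - p t) * hW

theorem exists_solutionBasis (a : ℝ → ℝ) (ha : IntegrableOn a (Icc 0 1) volume) :
    ∃ (φ φ' ψ ψ' : ℝ → ℝ → ℝ) (lam₀ : ℝ),
      (∀ lam, IsSolutionBasis (fun t => a t + lam) (φ lam) (φ' lam) (ψ lam) (ψ' lam)) ∧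
      IsLeast {lam | φ lam 1 + ψ' lam 1 = 2} lam₀ ∧
      ∀ lam < lam₀, 2 < φ lam 1 + ψ' lam 1 ∧ ∀ t ∈ Ioc (0 : ℝ) 1, 0 < ψ lam t := by
  have ha' : IntervalIntegrable a volume 0 1 :=
    (intervalIntegrable_iff_integrableOn_Icc_of_le zero_le_one).2 ha
  -- Removing the mean makes the primitive vanish at 1, so that `Q(1) = ψ'(1)`; the parameter shifts
  -- to `λ + m`.
  set m : ℝ := ∫ x in (0)..1, a x with hm
  have hb : IntervalIntegrable (fun t => a t - m) volume 0 1 :=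
    ha'.sub intervalIntegrable_const
  have hb1 : ∫ x in (0)..1, (a x - m) = 0 := by
    rw [intervalIntegral.integral_sub ha' intervalIntegrable_const]
    simp [hm]
  choose φ P ψ Q h using exists_isFundamental (continuousOn_primitive hb)
  obtain ⟨μ₀, hμ₀, hlt⟩ := exists_isLeast_discriminant (continuousOn_primitive hb) h
  refine ⟨fun lam => φ (lam + m), fun lam t => P (lam + m) t - (∫ x in (0)..t, (a x - m)) *
    φ (lam + m) t, fun lam => ψ (lam + m), fun lam t => Q (lam + m) t -
    (∫ x in (0)..t, (a x - m)) * ψ (lam + m) t, μ₀ - m, fun lam => ?_, ⟨?_, ?_⟩, ?_⟩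
  · have := (h (lam + m)).isSolutionBasis hb
    have e : (fun t => a t - m + (lam + m)) = fun t => a t + lam := by
      funext t
      ring
    rwa [e] at this
  · simpa [hb1] using hμ₀.1
  · intro lam hlam
    have : lam + m ∈ {μ | φ μ 1 + Q μ 1 = 2} := by simpa [hb1] using hlam
    linarith [hμ₀.2 this]
  · intro lam hlam
    simpa [hb1] using hlt (lam + m) (by linarith)

namespace IsSolutionBasis

variable {q φ' ψ' : ℝ → ℝ}

theorem derivWithin_comb (h : IsSolutionBasis q φ φ' ψ ψ') (α β : ℝ) {c d t : ℝ} (hc : 0 ≤ c)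
    (hcd : c < d) (hd : d ≤ 1) (ht : t ∈ Icc c d) :
    derivWithin (fun t => α * φ t + β * ψ t) (Icc c d) t = α * φ' t + β * ψ' t := by
  have hsub := Icc_subset_Icc hc hd
  exact ((((h.hasDeriv_left t (hsub ht)).const_mul α).add
    ((h.hasDeriv_right t (hsub ht)).const_mul β)).mono hsub).derivWithin
    (uniqueDiffOn_Icc hcd t ht)

/-- A periodic solution is a fixed vector of the monodromy matrix `T`, and `det (T - I) = 2 - Δ`
because `det T = 1`. -/
theorem exists_periodic_iff (h : IsSolutionBasis q φ φ' ψ ψ') :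
    (∃ u : ℝ → ℝ, SolvesOn q u 0 1 ∧ PeriodicBC u ∧ ∃ t ∈ Icc (0 : ℝ) 1, u t ≠ 0) ↔
      φ 1 + ψ' 1 = 2 := by
  have hW := h.wronskian 1 (by simp)
  constructor
  · rintro ⟨u, hu, ⟨h0, h1⟩, t, ht, hne⟩
    obtain ⟨α, β, hαβ⟩ := h.exists_eq u 0 1 le_rfl one_pos le_rfl hu
    rw [(hαβ 0 (by simp)).1, (hαβ 1 (by simp)).1, h.left_zero, h.right_zero] at h0
    rw [(hαβ 0 (by simp)).2, (hαβ 1 (by simp)).2, h.left_zero', h.right_zero'] at h1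
    have hα : α * (φ 1 + ψ' 1 - 2) = 0 := by
      linear_combination α * hW + (ψ' 1 - 1) * h0 - ψ 1 * h1
    have hβ : β * (φ 1 + ψ' 1 - 2) = 0 := by
      linear_combination β * hW + (φ 1 - 1) * h1 - φ' 1 * h0
    rcases mul_eq_zero.1 hα with hα | hα
    · rcases mul_eq_zero.1 hβ with hβ | hβ
      · rw [(hαβ t ht).1, hα, hβ] at hne
        simp at hne
      · linarith
    · linarith
  · intro hΔ
    -- A kernel vector of the singular matrix `T - I` is orthogonal to its rows: either row, if
    -- nonzero, supplies one, and otherwise `T = I`.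
    obtain ⟨α, β, h1, h2, hne⟩ : ∃ α β : ℝ, α = α * φ 1 + β * ψ 1 ∧ β = α * φ' 1 + β * ψ' 1 ∧
        (α ≠ 0 ∨ β ≠ 0) := by
      by_cases hc : ψ 1 ≠ 0 ∨ 1 - φ 1 ≠ 0
      · exact ⟨ψ 1, 1 - φ 1, by ring, by linear_combination hW - hΔ, hc⟩
      by_cases hc' : 1 - ψ' 1 ≠ 0 ∨ φ' 1 ≠ 0
      · exact ⟨1 - ψ' 1, φ' 1, by linear_combination hW - hΔ, by ring, hc'⟩
      push Not at hc hc'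
      exact ⟨1, 0, by linarith, by linarith, by simp⟩
    have hd0 := h.derivWithin_comb α β le_rfl one_pos le_rfl (t := 0) (by simp)
    have hd1 := h.derivWithin_comb α β le_rfl one_pos le_rfl (t := 1) (by simp)
    rw [h.left_zero', h.right_zero'] at hd0
    refine ⟨fun t => α * φ t + β * ψ t, h.solvesOn α β 0 1 le_rfl one_pos le_rfl, ⟨?_, ?_⟩, ?_⟩
    · simpa [h.left_zero, h.right_zero] using h1
    · rw [hd0, hd1]
      simpa using h2
    · by_contra! hz
      have hα : α = 0 := by simpa [h.left_zero, h.right_zero] using hz 0 (by simp)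
      have hβ : β = 0 := by
        rw [derivWithin_congr (f := fun _ => (0 : ℝ)) hz (hz 0 (by simp))] at hd0
        simpa using hd0.symm
      simp [hα, hβ] at hne

end IsSolutionBasis

end Hill

/-! ### Construction of the Green's functions. -/

namespace Hill

theorem SolvesOn.congr {q u v : ℝ → ℝ} {c d : ℝ} (h : SolvesOn q u c d)
    (huv : EqOn u v (Icc c d)) : SolvesOn q v c d := by
  -- Equality holds on the whole line, since `derivWithin` is 0 off the closed interval.
  have hd : derivWithin u (Icc c d) = derivWithin v (Icc c d) := by
    funext t
    by_cases ht : t ∈ Icc c d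
    · exact derivWithin_congr huv (huv ht)
    · rw [← isClosed_Icc.closure_eq] at ht
      rw [derivWithin_zero_of_notMem_closure ht, derivWithin_zero_of_notMem_closure ht]
  obtain ⟨h1, h2, h3⟩ := h
  refine ⟨h1.congr fun t ht => (huv ht).symm, hd ▸ h2, ?_⟩
  filter_upwards [h3, ae_restrict_mem measurableSet_Icc] with t ht hmem
  rwa [hd, huv hmem] at ht

/-- The function that equals `C s φ(t) + D s ψ(t)` for `t ≤ s` and
`(C s - ψ(s)) φ(t) + (D s + φ(s)) ψ(t)` for `s ≤ t`. -/
def kernel (φ ψ C D : ℝ → ℝ) (t s : ℝ) : ℝ :=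
  ψ (max t s) * φ s - φ (max t s) * ψ s + (C s * φ t + D s * ψ t)

theorem kernel_of_le {φ ψ : ℝ → ℝ} (C D : ℝ → ℝ) {t s : ℝ} (h : t ≤ s) :
    kernel φ ψ C D t s = C s * φ t + D s * ψ t := by
  rw [kernel, max_eq_right h]
  ring

theorem kernel_of_ge {φ ψ : ℝ → ℝ} (C D : ℝ → ℝ) {t s : ℝ} (h : s ≤ t) :
    kernel φ ψ C D t s = (C s - ψ s) * φ t + (D s + φ s) * ψ t := by
  rw [kernel, max_eq_left h]
  ring

namespace IsSolutionBasis

variable {q φ φ' ψ ψ' C D : ℝ → ℝ} {bc : (ℝ → ℝ) → Prop} {G : ℝ → ℝ → ℝ}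

theorem contDiffOn_left (h : IsSolutionBasis q φ φ' ψ ψ') : ContDiffOn ℝ 1 φ (Icc 0 1) :=
  contDiffOn_one_Icc one_pos h.hasDeriv_left h.continuousOn_left

theorem contDiffOn_right (h : IsSolutionBasis q φ φ' ψ ψ') : ContDiffOn ℝ 1 ψ (Icc 0 1) :=
  contDiffOn_one_Icc one_pos h.hasDeriv_right h.continuousOn_right

theorem derivWithin_eq_of_eventuallyEq (h : IsSolutionBasis q φ φ' ψ ψ') {f : ℝ → ℝ} {α β t : ℝ}
    (ht : t ∈ Icc (0 : ℝ) 1) (hf : f =ᶠ[𝓝[Icc 0 1] t] fun t => α * φ t + β * ψ t) :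
    derivWithin f (Icc 0 1) t = α * φ' t + β * ψ' t := by
  rw [hf.derivWithin_eq_of_mem ht, h.derivWithin_comb α β le_rfl one_pos le_rfl ht]

theorem deriv_eq_of_eventuallyEq (h : IsSolutionBasis q φ φ' ψ ψ') {f : ℝ → ℝ} {α β t : ℝ}
    (ht : t ∈ Ioo (0 : ℝ) 1) (hf : f =ᶠ[𝓝 t] fun t => α * φ t + β * ψ t) :
    deriv f t = α * φ' t + β * ψ' t := by
  rw [← h.derivWithin_eq_of_eventuallyEq (Ioo_subset_Icc_self ht)
    (hf.filter_mono nhdsWithin_le_nhds), derivWithin_of_mem_nhds (Icc_mem_nhds ht.1 ht.2)]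

/-- Apart from the boundary conditions, `kernel φ ψ C D` is a Green's function. -/
theorem isGreenFunction_kernel (h : IsSolutionBasis q φ φ' ψ ψ') (hC : ContDiffOn ℝ 1 C (Icc 0 1))
    (hD : ContDiffOn ℝ 1 D (Icc 0 1))
    (hbc : ∀ s ∈ Ioo (0 : ℝ) 1, bc fun t => kernel φ ψ C D t s) :
    IsGreenFunction q bc (kernel φ ψ C D) where
  continuousOn := by
    have hφ := h.contDiffOn_left.continuousOn
    have hψ := h.contDiffOn_right.continuousOn
    have hfst : ∀ {f : ℝ → ℝ}, ContinuousOn f (Icc 0 1) →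
        ContinuousOn (fun p : ℝ × ℝ => f p.1) (Icc 0 1 ×ˢ Icc 0 1) := fun hf =>
      hf.comp continuousOn_fst fun p hp => hp.1
    have hsnd : ∀ {f : ℝ → ℝ}, ContinuousOn f (Icc 0 1) →
        ContinuousOn (fun p : ℝ × ℝ => f p.2) (Icc 0 1 ×ˢ Icc 0 1) := fun hf =>
      hf.comp continuousOn_snd fun p hp => hp.2
    have hmax : ∀ {f : ℝ → ℝ}, ContinuousOn f (Icc 0 1) →
        ContinuousOn (fun p : ℝ × ℝ => f (max p.1 p.2)) (Icc 0 1 ×ˢ Icc 0 1) := fun hf =>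
      hf.comp (by fun_prop) fun p hp => ⟨le_max_of_le_left hp.1.1, max_le hp.1.2 hp.2.2⟩
    exact (((hmax hψ).mul (hsnd hφ)).sub ((hmax hφ).mul (hsnd hψ))).add
      (((hsnd hC.continuousOn).mul (hfst hφ)).add ((hsnd hD.continuousOn).mul (hfst hψ)))
  contDiffOn := by
    have hfst : ∀ {f : ℝ → ℝ}, ContDiffOn ℝ 1 f (Icc 0 1) →
        ContDiffOn ℝ 1 (fun p : ℝ × ℝ => f p.1) (Icc 0 1 ×ˢ Icc 0 1) := fun hf =>
      hf.comp contDiffOn_fst fun p hp => hp.1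
    have hsnd : ∀ {f : ℝ → ℝ}, ContDiffOn ℝ 1 f (Icc 0 1) →
        ContDiffOn ℝ 1 (fun p : ℝ × ℝ => f p.2) (Icc 0 1 ×ˢ Icc 0 1) := fun hf =>
      hf.comp contDiffOn_snd fun p hp => hp.2
    have hφ := h.contDiffOn_left
    have hψ := h.contDiffOn_right
    have hle := ((hsnd hC).mul (hfst hφ)).add ((hsnd hD).mul (hfst hψ))
    have hge := (((hsnd hC).sub (hsnd hψ)).mul (hfst hφ)).add
      (((hsnd hD).add (hsnd hφ)).mul (hfst hψ))
    rintro ⟨t, s⟩ ⟨hts, hne⟩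
    rcases lt_or_gt_of_ne (show t ≠ s from hne) with hlt | hgt
    · refine ((hle (t, s) hts).mono sdiff_subset).congr_of_eventuallyEq ?_ (kernel_of_le C D hlt.le)
      filter_upwards [nhdsWithin_le_nhds (isOpen_lt_prod.mem_nhds hlt)] with p hp
        using kernel_of_le C D (le_of_lt hp)
    · refine ((hge (t, s) hts).mono sdiff_subset).congr_of_eventuallyEq ?_ (kernel_of_ge C D hgt.le)
      filter_upwards [nhdsWithin_le_nhds ((isOpen_lt continuous_snd continuous_fst).mem_nhds hgt)]
        with p hp using kernel_of_ge C D (le_of_lt hp)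
  solves_left s hs := (h.solvesOn (C s) (D s) 0 s le_rfl hs.1 hs.2.le).congr fun t ht =>
    (kernel_of_le C D ht.2).symm
  solves_right s hs := (h.solvesOn (C s - ψ s) (D s + φ s) s 1 hs.1.le hs.2 le_rfl).congr
    fun t ht => (kernel_of_ge C D ht.1).symm
  boundary := hbc
  jump t ht := by
    have hn : Icc (0 : ℝ) 1 ∈ 𝓝 t := Icc_mem_nhds ht.1 ht.2
    have hlt : ∀ x ∈ Ioo (0 : ℝ) 1, ∀ s, x < s →
        deriv (fun y => kernel φ ψ C D y s) x = C s * φ' x + D s * ψ' x := fun x hx s hxs =>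
      h.deriv_eq_of_eventuallyEq hx <| by
        filter_upwards [Iio_mem_nhds hxs] with y hy using kernel_of_le C D (le_of_lt hy)
    have hgt : ∀ x ∈ Ioo (0 : ℝ) 1, ∀ s, s < x → deriv (fun y => kernel φ ψ C D y s) x =
        (C s - ψ s) * φ' x + (D s + φ s) * ψ' x := fun x hx s hxs =>
      h.deriv_eq_of_eventuallyEq hx <| by
        filter_upwards [Ioi_mem_nhds hxs] with y hy using kernel_of_ge C D (le_of_lt hy)
    have cφ : ContinuousAt φ t := h.contDiffOn_left.continuousOn.continuousAt hn
    have cψ : ContinuousAt ψ t := h.contDiffOn_right.continuousOn.continuousAt hn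
    have cφ' : ContinuousAt φ' t := h.continuousOn_left.continuousAt hn
    have cψ' : ContinuousAt ψ' t := h.continuousOn_right.continuousAt hn
    have cC : ContinuousAt C t := hC.continuousOn.continuousAt hn
    have cD : ContinuousAt D t := hD.continuousOn.continuousAt hn
    have hnear : ∀ᶠ x in 𝓝 t, x ∈ Ioo (0 : ℝ) 1 := Ioo_mem_nhds ht.1 ht.2
    refine ⟨C t * φ' t + D t * ψ' t, (C t - ψ t) * φ' t + (D t + φ t) * ψ' t,
      ?_, ?_, ?_, ?_, ?_⟩
    · have c : ContinuousAt (fun x => C t * φ' x + D t * ψ' x) t := by fun_prop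
      refine (c.tendsto.mono_left nhdsWithin_le_nhds).congr' ?_
      filter_upwards [nhdsWithin_le_nhds hnear, self_mem_nhdsWithin] with x hx hxt
        using (hlt x hx t hxt).symm
    · have c : ContinuousAt (fun s => C s * φ' t + D s * ψ' t) t := by fun_prop
      refine (c.tendsto.mono_left nhdsWithin_le_nhds).congr' ?_
      filter_upwards [self_mem_nhdsWithin] with s hs using (hlt t ht s hs).symm
    · have c : ContinuousAt (fun x => (C t - ψ t) * φ' x + (D t + φ t) * ψ' x) t := by fun_prop
      refine (c.tendsto.mono_left nhdsWithin_le_nhds).congr' ?_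
      filter_upwards [nhdsWithin_le_nhds hnear, self_mem_nhdsWithin] with x hx hxt
        using (hgt x hx t hxt).symm
    · have c : ContinuousAt (fun s => (C s - ψ s) * φ' t + (D s + φ s) * ψ' t) t := by fun_prop
      refine (c.tendsto.mono_left nhdsWithin_le_nhds).congr' ?_
      filter_upwards [self_mem_nhdsWithin] with s hs using (hgt t ht s hs).symm
    · linear_combination h.wronskian t (Ioo_subset_Icc_self ht)

theorem exists_green_dirichlet (h : IsSolutionBasis q φ φ' ψ ψ') (hψ : ψ 1 ≠ 0) :
    ∃ G, IsGreenFunction q DirichletBC G := by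
  refine ⟨_, h.isGreenFunction_kernel (C := fun _ => 0) (D := fun s => φ 1 / ψ 1 * ψ s - φ s)
    contDiffOn_const ((contDiffOn_const.mul h.contDiffOn_right).sub h.contDiffOn_left)
    fun s hs => ⟨?_, ?_⟩⟩
  · beta_reduce
    rw [kernel_of_le _ _ hs.1.le, h.right_zero]
    ring
  · beta_reduce
    rw [kernel_of_ge _ _ hs.2.le]
    field_simp
    ring

theorem exists_green_periodic (h : IsSolutionBasis q φ φ' ψ ψ') (hΔ : φ 1 + ψ' 1 ≠ 2) :
    ∃ G, IsGreenFunction q PeriodicBC G := by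
  have hW := h.wronskian 1 (by simp)
  have hne : 2 - (φ 1 + ψ' 1) ≠ 0 := sub_ne_zero.2 hΔ.symm
  set k := (2 - (φ 1 + ψ' 1))⁻¹ with hk
  have hkΔ : k * (2 - (φ 1 + ψ' 1)) = 1 := inv_mul_cancel₀ hne
  have hc : ∀ x y : ℝ, ContDiffOn ℝ 1 (fun s => k * (x * φ s + y * ψ s)) (Icc 0 1) := fun x y =>
    contDiffOn_const.mul ((contDiffOn_const.mul h.contDiffOn_left).add
      (contDiffOn_const.mul h.contDiffOn_right))
  -- Periodicity reads `(I - T)(C, D) = T(-ψ(s), φ(s))`; as `det T = 1`, its solution is `k (T -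
  -- I)(-ψ(s), φ(s))`.
  refine ⟨_, h.isGreenFunction_kernel (hc (ψ 1) (1 - φ 1)) (hc (ψ' 1 - 1) (-φ' 1))
    fun s hs => ⟨?_, ?_⟩⟩
  · beta_reduce
    rw [kernel_of_le _ _ hs.1.le, kernel_of_ge _ _ hs.2.le, h.left_zero, h.right_zero]
    linear_combination (ψ 1 * φ s - φ 1 * ψ s) * hkΔ - k * ψ s * hW
  · rw [h.derivWithin_eq_of_eventuallyEq (t := 0) (by simp) (nhdsWithin_le_nhds <| by
      filter_upwards [Iio_mem_nhds hs.1] with y hy using kernel_of_le _ _ (le_of_lt hy)),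
      h.derivWithin_eq_of_eventuallyEq (t := 1) (by simp) (nhdsWithin_le_nhds <| by
      filter_upwards [Ioi_mem_nhds hs.2] with y hy using kernel_of_ge _ _ (le_of_lt hy)),
      h.left_zero', h.right_zero']
    linear_combination (ψ' 1 * φ s - φ' 1 * ψ s) * hkΔ + k * φ s * hW

/-! ### Uniqueness and comparison of Green's functions. -/

/-- For fixed `s`, every Green's function is a kernel. -/
theorem exists_coeff (h : IsSolutionBasis q φ φ' ψ ψ') (hG : IsGreenFunction q bc G) {s : ℝ}
    (hs : s ∈ Ioo (0 : ℝ) 1) :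
    ∃ α β : ℝ, (∀ t ∈ Icc 0 s, G t s = α * φ t + β * ψ t) ∧
      ∀ t ∈ Icc s 1, G t s = (α - ψ s) * φ t + (β + φ s) * ψ t := by
  obtain ⟨α, β, hl⟩ := h.exists_eq _ 0 s le_rfl hs.1 hs.2.le (hG.solves_left s hs)
  obtain ⟨γ, δ, hr⟩ := h.exists_eq _ s 1 hs.1.le hs.2 le_rfl (hG.solves_right s hs)
  obtain ⟨l, r, h1, -, h2, -, hjump⟩ := hG.jump s hs
  have hn : Icc (0 : ℝ) 1 ∈ 𝓝 s := Icc_mem_nhds hs.1 hs.2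
  have cφ' : ContinuousAt φ' s := h.continuousOn_left.continuousAt hn
  have cψ' : ContinuousAt ψ' s := h.continuousOn_right.continuousAt hn
  have c : ∀ x y : ℝ, ContinuousAt (fun t => x * φ' t + y * ψ' t) s := fun x y => by fun_prop
  have hleft : l = α * φ' s + β * ψ' s := by
    refine tendsto_nhds_unique h1 (((c α β).tendsto.mono_left nhdsWithin_le_nhds).congr' ?_)
    filter_upwards [Ioo_mem_nhdsLT hs.1] with x hx
    refine (h.deriv_eq_of_eventuallyEq ⟨hx.1, hx.2.trans hs.2⟩ ?_).symm
    filter_upwards [Icc_mem_nhds hx.1 hx.2] with y hy using (hl y hy).1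
  have hright : r = γ * φ' s + δ * ψ' s := by
    refine tendsto_nhds_unique h2 (((c γ δ).tendsto.mono_left nhdsWithin_le_nhds).congr' ?_)
    filter_upwards [Ioo_mem_nhdsGT hs.2] with x hx
    refine (h.deriv_eq_of_eventuallyEq ⟨hs.1.trans hx.1, hx.2⟩ ?_).symm
    filter_upwards [Icc_mem_nhds hx.1 hx.2] with y hy using (hr y hy).1
  have heq : α * φ s + β * ψ s = γ * φ s + δ * ψ s :=
    (hl s (right_mem_Icc.2 hs.1.le)).1.symm.trans (hr s (left_mem_Icc.2 hs.2.le)).1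
  have hW := h.wronskian s (Ioo_subset_Icc_self hs)
  rw [hleft, hright] at hjump
  -- Continuity and the unit jump at `s` form a linear system for the coefficient differences, with
  -- the Wronskian 1 as determinant.
  have hγ : γ = α - ψ s := by
    linear_combination (α - γ) * hW - ψ' s * heq - ψ s * hjump
  have hδ : δ = β + φ s := by
    linear_combination (β - δ) * hW + φ' s * heq + φ s * hjump
  exact ⟨α, β, fun t ht => (hl t ht).1, fun t ht => by rw [(hr t ht).1, hγ, hδ]⟩

/-- On an interval of disconjugacy, the solution vanishing at `1` is positive inside. -/
theorem pos_left_of_pos (h : IsSolutionBasis q φ φ' ψ ψ') (hψ : ∀ t ∈ Ioc (0 : ℝ) 1, 0 < ψ t)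
    {t : ℝ} (ht : t ∈ Ioo (0 : ℝ) 1) : 0 < ψ 1 * φ t - φ 1 * ψ t := by
  have hsub : Icc t 1 ⊆ Icc 0 1 := Icc_subset_Icc_left ht.1.le
  have hpos : ∀ x ∈ Icc t 1, 0 < ψ x := fun x hx => hψ x ⟨ht.1.trans_le hx.1, hx.2⟩
  -- The Wronskian gives `(φ / ψ)' = -1 / ψ²`.
  have hanti : StrictAntiOn (fun x => φ x / ψ x) (Icc t 1) := by
    refine strictAntiOn_of_deriv_neg (convex_Icc t 1)
      ((h.contDiffOn_left.continuousOn.mono hsub).div (h.contDiffOn_right.continuousOn.mono hsub)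
        fun x hx => (hpos x hx).ne') fun x hx => ?_
    rw [interior_Icc] at hx
    have hx' := Ioo_subset_Icc_self hx
    have hn : Icc (0 : ℝ) 1 ∈ 𝓝 x := Icc_mem_nhds (ht.1.trans hx.1) hx.2
    have hd := ((h.hasDeriv_left x (hsub hx')).hasDerivAt hn).div
      ((h.hasDeriv_right x (hsub hx')).hasDerivAt hn) (hpos x hx').ne'
    have e : (fun x => φ x / ψ x) = φ / ψ := rfl
    rw [e, hd.deriv]
    refine div_neg_of_neg_of_pos ?_ (pow_pos (hpos x hx') 2)
    linarith [h.wronskian x (hsub hx')]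
  have := hanti (left_mem_Icc.2 ht.2.le) (right_mem_Icc.2 ht.2.le) ht.2
  simp only at this
  rw [div_lt_div_iff₀ (hpos 1 (by simp [ht.2.le])) (hpos t (by simp [ht.2.le]))] at this
  linarith

theorem green_lt (h : IsSolutionBasis q φ φ' ψ ψ') (hΔ : 2 < φ 1 + ψ' 1)
    (hψ : ∀ t ∈ Ioc (0 : ℝ) 1, 0 < ψ t) {GP GD : ℝ → ℝ → ℝ}
    (hP : IsGreenFunction q PeriodicBC GP) (hD : IsGreenFunction q DirichletBC GD) {t s : ℝ}
    (ht : t ∈ Ioo (0 : ℝ) 1) (hs : s ∈ Ioo (0 : ℝ) 1) : GP t s < GD t s ∧ GD t s < 0 := by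
  obtain ⟨α, β, hPl, hPr⟩ := h.exists_coeff hP hs
  obtain ⟨α', β', hDl, hDr⟩ := h.exists_coeff hD hs
  have hW := h.wronskian 1 (by simp)
  have hψ1 : 0 < ψ 1 := hψ 1 (by simp)
  have hψt := hψ t (Ioo_subset_Ioc_self ht)
  have hψs := hψ s (Ioo_subset_Ioc_self hs)
  have hχt := h.pos_left_of_pos hψ ht
  have hχs := h.pos_left_of_pos hψ hs
  have hD0 := (hD.boundary s hs).1
  have hD1 := (hD.boundary s hs).2
  have hP0 := (hP.boundary s hs).1
  have hP1 := (hP.boundary s hs).2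
  simp only [hDl 0 (left_mem_Icc.2 hs.1.le), hDr 1 (right_mem_Icc.2 hs.2.le),
    hPl 0 (left_mem_Icc.2 hs.1.le), hPr 1 (right_mem_Icc.2 hs.2.le), h.left_zero,
    h.right_zero] at hD0 hD1 hP0
  rw [h.derivWithin_eq_of_eventuallyEq (t := 0) (α := α) (β := β) (by simp) (by
      filter_upwards [self_mem_nhdsWithin, nhdsWithin_le_nhds (Iio_mem_nhds hs.1)] with y hy hy'
        using hPl y ⟨hy.1, le_of_lt hy'⟩),
    h.derivWithin_eq_of_eventuallyEq (t := 1) (α := α - ψ s) (β := β + φ s) (by simp) (by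
      filter_upwards [self_mem_nhdsWithin, nhdsWithin_le_nhds (Ioi_mem_nhds hs.2)] with y hy hy'
        using hPr y ⟨le_of_lt hy', hy.2⟩), h.left_zero', h.right_zero'] at hP1
  have hα' : α' = 0 := by linarith
  subst hα'
  -- The number `α` is `G_P(0, s)`. Eliminating `β` from the two periodic conditions gives `α (2 -
  -- Δ) = χ(s) + ψ(s)`, where `2 - Δ < 0`.
  have hα : α < 0 := by
    have e : α * (2 - (φ 1 + ψ' 1)) = (ψ 1 * φ s - φ 1 * ψ s) + ψ s := by
      linear_combination (1 - ψ' 1) * hP0 + ψ 1 * hP1 + (ψ s - α) * hW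
    by_contra! hc
    nlinarith
  -- One formula serves both sides of the diagonal because the jumps cancel.
  have hdiff : (GP t s - GD t s) * ψ 1 = α * ((ψ 1 * φ t - φ 1 * ψ t) + ψ t) := by
    rcases le_total t s with hts | hst
    · rw [hPl t ⟨ht.1.le, hts⟩, hDl t ⟨ht.1.le, hts⟩]
      linear_combination (-ψ t) * (hP0 + hD1)
    · rw [hPr t ⟨hst, ht.2.le⟩, hDr t ⟨hst, ht.2.le⟩]
      linear_combination (-ψ t) * (hP0 + hD1)
  have hneg : GD t s * ψ 1 < 0 := by
    rcases le_total t s with hts | hst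
    · have e : GD t s * ψ 1 = -(ψ t * (ψ 1 * φ s - φ 1 * ψ s)) := by
        rw [hDl t ⟨ht.1.le, hts⟩]
        linear_combination ψ t * hD1
      rw [e]
      exact neg_neg_of_pos (mul_pos hψt hχs)
    · have e : GD t s * ψ 1 = -(ψ s * (ψ 1 * φ t - φ 1 * ψ t)) := by
        rw [hDr t ⟨hst, ht.2.le⟩]
        linear_combination ψ t * hD1
      rw [e]
      exact neg_neg_of_pos (mul_pos hψs hχt)
  refine ⟨?_, neg_of_mul_neg_left hneg hψ1.le⟩
  have : (GP t s - GD t s) * ψ 1 < 0 := by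
    rw [hdiff]
    exact mul_neg_of_neg_of_pos hα (by linarith)
  linarith [neg_of_mul_neg_left this hψ1.le]

end IsSolutionBasis

end Hill

theorem mainTheorem2 (a : ℝ → ℝ) (ha : IntegrableOn a (Icc 0 1) volume) :
    ∃ lam0P : ℝ, IsLeast {μ : ℝ | Hill.IsEigenvalue a Hill.PeriodicBC μ} lam0P ∧
      ∀ lam : ℝ, lam < lam0P →
        (∃ GP : ℝ → ℝ → ℝ,
          Hill.IsGreenFunction (fun t => a t + lam) Hill.PeriodicBC GP) ∧
        (∃ GD : ℝ → ℝ → ℝ,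
          Hill.IsGreenFunction (fun t => a t + lam) Hill.DirichletBC GD) ∧
        ∀ GP GD : ℝ → ℝ → ℝ,
          Hill.IsGreenFunction (fun t => a t + lam) Hill.PeriodicBC GP →
          Hill.IsGreenFunction (fun t => a t + lam) Hill.DirichletBC GD →
          ∀ t ∈ Ioo (0 : ℝ) 1, ∀ s ∈ Ioo (0 : ℝ) 1, GP t s < GD t s ∧ GD t s < 0 := by
  obtain ⟨φ, φ', ψ, ψ', lam₀, hbasis, hleast, hlt⟩ := Hill.exists_solutionBasis a ha
  have hset : {μ : ℝ | Hill.IsEigenvalue a Hill.PeriodicBC μ} =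
      {lam | φ lam 1 + ψ' lam 1 = 2} := by
    ext lam
    exact (hbasis lam).exists_periodic_iff
  refine ⟨lam₀, hset ▸ hleast, fun lam hlam => ?_⟩
  obtain ⟨hΔ, hpos⟩ := hlt lam hlam
  exact ⟨(hbasis lam).exists_green_periodic hΔ.ne',
    (hbasis lam).exists_green_dirichlet (hpos 1 (by simp)).ne',
    fun GP GD hP hD t ht s hs => (hbasis lam).green_lt hΔ hpos hP hD ht hs⟩
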